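/- A free Banach lattice generated by a lattice $\mathbb{L}$ is a (real) Banach lattice $FBL\langle\mathbb{L}\rangle$ together with a norm-bounded lattice homomorphism $\delta_{\mathbb{L}}\colon\mathbb{L}\to FBL\langle\mathbb{L}\rangle$ such that for every Banach lattice $X$ and every norm-bounded lattice homomorphism $T\colon\mathbb{L}\to X$ there is a unique Banach lattice homomorphism (bounded linear operator preserving $\vee$ and $\wedge$) $\hat T\colon FBL\langle\mathbb{L}\rangle\to X$ with $\hat T\circ\delta_{\mathbb{L}}=T$, and moreover $\|\hat T\|=\sup\{\|T(x)\|:x\in\mathbb{L}\}$ (read as $0$ if $\mathbb{L}=\emptyset$). **Theorem.** Let $\mathbb{M}$ be a distributive lattice, let $\mathbb{L}\subseteq\mathbb{M}$ be a sublattice with inclusion $i\colon\mathbb{L}\to\mathbb{M}$, and let $\hat\imath\colon FBL\langle\mathbb{L}\rangle\to FBL\langle\mathbb{M}\rangle$ be the induced Banach lattice homomorphism, that is, the unique one with $\hat\imath\circ\delta_{\mathbb{L}}=\delta_{\mathbb{M}}\circ i$. The following are equivalent: 1. $\hat\imath$ is an into isomorphism, i.e. an isomorphism onto its range: there is $c>0$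 with $c\|f\|\le\|\hat\imath(f)\|$ for every $f\in FBL\langle\mathbb{L}\rangle$; 2. $\hat\imath$ is injective; 3. every lattice homomorphism $y^*\colon\mathbb{L}\to[-1,1]$ extends to a lattice homomorphism $\hat y^*\colon\mathbb{M}\to[-1,1]$. -/

import Mathlib

universe u

/-- Real Banach lattices: complete normed vector lattices whose norm is monotone in the absolute
value. -/
class IsBanachLattice (X : Type u) [NormedAddCommGroup X] [NormedSpace ℝ X] [Lattice X] : Prop where
  isOrderedAddMonoid : IsOrderedAddMonoid X
  isOrderedModule : IsOrderedModule ℝ X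
  hasSolidNorm : HasSolidNorm X
  completeSpace : CompleteSpace X

attribute [instance] IsBanachLattice.isOrderedAddMonoid IsBanachLattice.isOrderedModule
  IsBanachLattice.hasSolidNorm IsBanachLattice.completeSpace

/-- Banach lattice homomorphisms: bounded linear operators which preserve the lattice
operations. -/
structure BanachLatticeHom (X Y : Type u) [NormedAddCommGroup X] [NormedSpace ℝ X] [Lattice X]
    [NormedAddCommGroup Y] [NormedSpace ℝ Y] [Lattice Y] where
  toCLM : X →L[ℝ] Y
  map_sup : ∀ a b : X, toCLM (a ⊔ b) = toCLM a ⊔ toCLM b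
  map_inf : ∀ a b : X, toCLM (a ⊓ b) = toCLM a ⊓ toCLM b

namespace BanachLatticeHom

variable {X Y : Type u} [NormedAddCommGroup X] [NormedSpace ℝ X] [Lattice X]
    [NormedAddCommGroup Y] [NormedSpace ℝ Y] [Lattice Y]

instance : CoeFun (BanachLatticeHom X Y) (fun _ => X → Y) := ⟨fun T => T.toCLM⟩

/-- `T` is an into isomorphism (an isomorphic embedding), i.e. an isomorphism onto its range.
As `T` is bounded, this says that `T` is bounded below. -/
def IsIntoIsomorphism (T : BanachLatticeHom X Y) : Prop :=
  ∃ c : ℝ, 0 < c ∧ ∀ f : X, c * ‖f‖ ≤ ‖T f‖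

end BanachLatticeHom

/-- A map into a normed space is norm-bounded if its range is. -/
def NormBounded {L X : Type u} [NormedAddCommGroup X] (T : L → X) : Prop :=
  BddAbove (Set.range fun x => ‖T x‖)

/-- The norm `sup {‖T x‖ : x ∈ L}` of a norm-bounded map (it is `0` when `L` is empty). -/
noncomputable def supNorm {L X : Type u} [NormedAddCommGroup X] (T : L → X) : ℝ :=
  ⨆ x, ‖T x‖

/-- `F` together with `δ : L → F` is a free Banach lattice generated by the lattice `L`: the map
`δ` is a norm-bounded lattice homomorphism, and every norm-bounded lattice homomorphism `T` from
`L` to a Banach lattice `X` is `T' ∘ δ` for a unique Banach lattice homomorphism `T' : F → X`, and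
moreover `‖T'‖ = ‖T‖`. -/
structure IsFreeBanachLattice (L : Type u) [Lattice L] (F : Type u) [NormedAddCommGroup F]
    [NormedSpace ℝ F] [Lattice F] [IsBanachLattice F] (δ : LatticeHom L F) : Prop where
  normBounded : NormBounded δ
  existsUnique_lift : ∀ (X : Type u) [NormedAddCommGroup X] [NormedSpace ℝ X] [Lattice X]
    [IsBanachLattice X] (T : LatticeHom L X), NormBounded T →
    ∃ T' : BanachLatticeHom F X, (∀ x, T' (δ x) = T x) ∧ ‖T'.toCLM‖ = supNorm T ∧
      ∀ S : BanachLatticeHom F X, (∀ x, S (δ x) = T x) → S = T'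

namespace IsFreeBanachLattice

variable {L : Type u} [Lattice L] {F : Type u} [NormedAddCommGroup F] [NormedSpace ℝ F]
  [Lattice F] [IsBanachLattice F] {δ : LatticeHom L F} {X : Type u} [NormedAddCommGroup X]
  [NormedSpace ℝ X] [Lattice X] [IsBanachLattice X]

/-- The Banach lattice homomorphism given by the universal property. -/
noncomputable def lift (hF : IsFreeBanachLattice L F δ) (T : LatticeHom L X) (hT : NormBounded T) :
    BanachLatticeHom F X :=
  (hF.existsUnique_lift X T hT).choose

theorem lift_apply (hF : IsFreeBanachLattice L F δ) (T : LatticeHom L X) (hT : NormBounded T)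
    (x : L) : hF.lift T hT (δ x) = T x :=
  (hF.existsUnique_lift X T hT).choose_spec.1 x

theorem norm_lift (hF : IsFreeBanachLattice L F δ) (T : LatticeHom L X) (hT : NormBounded T) :
    ‖(hF.lift T hT).toCLM‖ = supNorm T :=
  (hF.existsUnique_lift X T hT).choose_spec.2.1

theorem eq_lift (hF : IsFreeBanachLattice L F δ) (T : LatticeHom L X) (hT : NormBounded T)
    (S : BanachLatticeHom F X) (hS : ∀ x, S (δ x) = T x) : S = hF.lift T hT :=
  (hF.existsUnique_lift X T hT).choose_spec.2.2 S hS

end IsFreeBanachLattice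

/-- For a sublattice `L` of `M` and free Banach lattices `F`, `G` generated by `L` and `M`, the
Banach lattice homomorphism `F → G` induced by the inclusion, i.e. the one which maps the generator
`δL x` to the generator `δM x` for each `x ∈ L`. -/
noncomputable def inducedMap {M : Type u} [Lattice M] (L : Sublattice M)
    {F : Type u} [NormedAddCommGroup F] [NormedSpace ℝ F] [Lattice F] [IsBanachLattice F]
    {G : Type u} [NormedAddCommGroup G] [NormedSpace ℝ G] [Lattice G] [IsBanachLattice G]
    {δL : LatticeHom L F} {δM : LatticeHom M G} (hF : IsFreeBanachLattice L F δL)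
    (hG : IsFreeBanachLattice M G δM) : BanachLatticeHom F G :=
  hF.lift (δM.comp L.subtype) (hG.normBounded.mono (by rintro _ ⟨x, rfl⟩; exact ⟨x, rfl⟩))

theorem inducedMap_apply {M : Type u} [Lattice M] (L : Sublattice M)
    {F : Type u} [NormedAddCommGroup F] [NormedSpace ℝ F] [Lattice F] [IsBanachLattice F]
    {G : Type u} [NormedAddCommGroup G] [NormedSpace ℝ G] [Lattice G] [IsBanachLattice G]
    {δL : LatticeHom L F} {δM : LatticeHom M G} (hF : IsFreeBanachLattice L F δL)
    (hG : IsFreeBanachLattice M G δM) (x : L) : inducedMap L hF hG (δL x) = δM x :=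
  hF.lift_apply _ _ x

/-! The rest of this file shows that every lattice does generate a free Banach lattice. It is
obtained from vector lattice terms with generators in `L`, identified when they agree under every
lattice homomorphism of `L` into the unit ball of a Banach lattice, by completion. -/

namespace FreeBanachLattice

/-- A lattice homomorphism from `L` to the unit ball of a Banach lattice. -/
structure Test (L : Type u) [Lattice L] where
  X : Type u
  [g : NormedAddCommGroup X]
  [s : NormedSpace ℝ X]
  [l : Lattice X]
  [b : IsBanachLattice X]
  T : LatticeHom L X
  le_one : ∀ x, ‖T x‖ ≤ 1

attribute [instance] Test.g Test.s Test.l Test.b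

/-- Vector lattice terms. -/
inductive Term (L : Type u) : Type u
  | of (x : L) : Term L
  | zero : Term L
  | add (a b : Term L) : Term L
  | smul (r : ℝ) (a : Term L) : Term L
  | sup (a b : Term L) : Term L

/-- A lattice from its operations. -/
abbrev latticeOfEq {α : Type u} (s i : α → α → α) (s_comm : ∀ a b, s a b = s b a)
    (s_assoc : ∀ a b c, s (s a b) c = s a (s b c)) (i_comm : ∀ a b, i a b = i b a)
    (i_assoc : ∀ a b c, i (i a b) c = i a (i b c)) (s_i_self : ∀ a b, s a (i a b) = a)
    (i_s_self : ∀ a b, i a (s a b) = a) : Lattice α where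
  sup := s
  inf := i
  le a b := s a b = b
  le_refl a := by
    have h := s_i_self a (s a a)
    rwa [i_s_self] at h
  le_trans a b c h k := by rw [← k, ← s_assoc, h]
  le_antisymm a b h k := by rw [← h, s_comm, k]
  le_sup_left a b := by
    have h := s_i_self a (s a a)
    rw [i_s_self] at h
    rw [← s_assoc, h]
  le_sup_right a b := by
    have h := s_i_self b (s b b)
    rw [i_s_self] at h
    rw [s_comm a b, ← s_assoc, h]
  sup_le a b c h k := by rw [s_assoc, k, h]
  inf_le_left a b := by rw [s_comm, s_i_self]
  inf_le_right a b := by rw [s_comm, i_comm, s_i_self]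
  le_inf a b c h k := by
    have h1 : i a b = a := by rw [← h, i_s_self]
    have h2 : i a c = a := by rw [← k, i_s_self]
    have h3 : i a (i b c) = a := by rw [← i_assoc, h1, h2]
    rw [← h3, s_comm, i_comm a, s_i_self]

variable {L : Type u} [Lattice L]

/-- The value of a term. -/
def Test.eval (P : Test L) : Term L → P.X
  | .of x => P.T x
  | .zero => 0
  | .add a b => P.eval a + P.eval b
  | .smul r a => r • P.eval a
  | .sup a b => P.eval a ⊔ P.eval b

/-- A bound for the values of a term. -/
def bound : Term L → ℝ
  | .of _ => 1
  | .zero => 0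
  | .add a b => bound a + bound b
  | .smul r a => |r| * bound a
  | .sup a b => bound a + bound b

theorem Test.norm_eval_le (P : Test L) (t : Term L) : ‖P.eval t‖ ≤ bound t := by
  induction t with
  | of x => exact P.le_one x
  | zero => simp [Test.eval, bound]
  | add a b ha hb => exact (norm_add_le _ _).trans (add_le_add ha hb)
  | smul r a ha =>
    simp only [Test.eval, bound, norm_smul, Real.norm_eq_abs]
    gcongr
  | sup a b ha hb => exact (norm_sup_le_add _ _).trans (add_le_add ha hb)

variable (L) in
/-- Terms are identified when they agree under all tests. -/
def setoid : Setoid (Term L) where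
  r s t := ∀ P : Test L, P.eval s = P.eval t
  iseqv := ⟨fun _ _ => rfl, fun h P => (h P).symm, fun h k P => (h P).trans (k P)⟩

variable (L) in
/-- The free normed vector lattice over `L`. -/
def Pre : Type u := Quotient (setoid L)

/-- The class of a term. -/
def Pre.mk (t : Term L) : Pre L := Quotient.mk _ t

/-- The value of an element of the free normed vector lattice. -/
def Test.ev (P : Test L) : Pre L → P.X := Quotient.lift P.eval fun _ _ h => h P

theorem Pre.ext {a b : Pre L} (h : ∀ P : Test L, P.ev a = P.ev b) : a = b := by
  induction a using Quotient.inductionOn with | _ a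
  induction b using Quotient.inductionOn with | _ b
  exact Quotient.sound h

instance : Zero (Pre L) := ⟨Quotient.mk _ .zero⟩
instance : Add (Pre L) := ⟨Quotient.map₂ .add fun _ _ h _ _ k P => by
  simp only [Test.eval, h P, k P]⟩
/-- The supremum. -/
def Pre.sup : Pre L → Pre L → Pre L := Quotient.map₂ .sup fun _ _ h _ _ k P => by
  simp only [Test.eval, h P, k P]
instance : SMul ℝ (Pre L) := ⟨fun r => Quotient.map (.smul r) fun _ _ h P => by
  simp only [Test.eval, h P]⟩
instance : Neg (Pre L) := ⟨fun a => (-1 : ℝ) • a⟩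
/-- The infimum. -/
def Pre.inf (a b : Pre L) : Pre L := -Pre.sup (-a) (-b)

@[simp] theorem ev_zero (P : Test L) : P.ev 0 = 0 := rfl

@[simp] theorem ev_add (P : Test L) (a b : Pre L) : P.ev (a + b) = P.ev a + P.ev b := by
  induction a using Quotient.inductionOn with | _ a
  induction b using Quotient.inductionOn with | _ b
  rfl

theorem ev_psup (P : Test L) (a b : Pre L) : P.ev (Pre.sup a b) = P.ev a ⊔ P.ev b := by
  induction a using Quotient.inductionOn with | _ a
  induction b using Quotient.inductionOn with | _ b
  rfl

@[simp] theorem ev_smul (P : Test L) (r : ℝ) (a : Pre L) : P.ev (r • a) = r • P.ev a := by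
  induction a using Quotient.inductionOn with | _ a
  rfl

@[simp] theorem ev_neg (P : Test L) (a : Pre L) : P.ev (-a) = -P.ev a := by
  change P.ev ((-1 : ℝ) • a) = _
  simp

theorem ev_pinf (P : Test L) (a b : Pre L) : P.ev (Pre.inf a b) = P.ev a ⊓ P.ev b := by
  rw [Pre.inf, ev_neg, ev_psup, ev_neg, ev_neg, neg_sup, neg_neg, neg_neg]

instance : AddCommGroup (Pre L) where
  add_assoc a b c := Pre.ext fun P => by simp [add_assoc]
  zero_add a := Pre.ext fun P => by simp
  add_zero a := Pre.ext fun P => by simp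
  nsmul := nsmulRec
  zsmul := zsmulRec
  neg_add_cancel a := Pre.ext fun P => by simp
  add_comm a b := Pre.ext fun P => by simp [add_comm]

@[simp] theorem ev_sub (P : Test L) (a b : Pre L) : P.ev (a - b) = P.ev a - P.ev b := by
  simp [sub_eq_add_neg]

instance : Module ℝ (Pre L) where
  one_smul a := Pre.ext fun P => by simp
  mul_smul r s a := Pre.ext fun P => by simp [mul_smul]
  smul_zero r := Pre.ext fun P => by simp
  smul_add r a b := Pre.ext fun P => by simp
  add_smul r s a := Pre.ext fun P => by simp [add_smul]
  zero_smul a := Pre.ext fun P => by simp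

instance : Lattice (Pre L) := latticeOfEq Pre.sup Pre.inf
  (fun a b => Pre.ext fun P => by simp [ev_psup, sup_comm])
  (fun a b c => Pre.ext fun P => by simp [ev_psup, sup_assoc])
  (fun a b => Pre.ext fun P => by simp [ev_pinf, inf_comm])
  (fun a b c => Pre.ext fun P => by simp [ev_pinf, inf_assoc])
  (fun a b => Pre.ext fun P => by simp [ev_psup, ev_pinf])
  (fun a b => Pre.ext fun P => by simp [ev_psup, ev_pinf])

@[simp] theorem ev_sup (P : Test L) (a b : Pre L) : P.ev (a ⊔ b) = P.ev a ⊔ P.ev b :=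
  ev_psup P a b

@[simp] theorem ev_inf (P : Test L) (a b : Pre L) : P.ev (a ⊓ b) = P.ev a ⊓ P.ev b :=
  ev_pinf P a b

theorem Pre.le_iff {a b : Pre L} : a ≤ b ↔ ∀ P : Test L, P.ev a ≤ P.ev b := by
  rw [← sup_eq_right]
  constructor
  · intro h P
    rw [← sup_eq_right, ← ev_sup, h]
  · intro h
    exact Pre.ext fun P => by simpa using h P

@[simp] theorem ev_abs (P : Test L) (a : Pre L) : P.ev |a| = |P.ev a| := by
  simp [abs]

noncomputable instance : Norm (Pre L) := ⟨fun a => ⨆ P : Test L, ‖P.ev a‖⟩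

theorem Pre.norm_def (a : Pre L) : ‖a‖ = ⨆ P : Test L, ‖P.ev a‖ := rfl

theorem Pre.bddAbove (a : Pre L) : BddAbove (Set.range fun P : Test L => ‖P.ev a‖) := by
  induction a using Quotient.inductionOn with | _ a
  exact ⟨bound a, by rintro _ ⟨P, rfl⟩; exact P.norm_eval_le a⟩

theorem Test.norm_ev_le (P : Test L) (a : Pre L) : ‖P.ev a‖ ≤ ‖a‖ :=
  le_ciSup (Pre.bddAbove a) P

theorem Pre.norm_le {a : Pre L} {r : ℝ} (hr : 0 ≤ r) (h : ∀ P : Test L, ‖P.ev a‖ ≤ r) :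
    ‖a‖ ≤ r := Real.iSup_le h hr

theorem Pre.norm_nonneg (a : Pre L) : 0 ≤ ‖a‖ := Real.iSup_nonneg fun _ => _root_.norm_nonneg _

theorem Pre.core : NormedSpace.Core ℝ (Pre L) where
  norm_nonneg := Pre.norm_nonneg
  norm_smul r a := by
    simp only [Pre.norm_def, ev_smul, norm_smul]
    exact (Real.mul_iSup_of_nonneg (_root_.norm_nonneg r) _).symm
  norm_triangle a b := Pre.norm_le (add_nonneg (Pre.norm_nonneg a) (Pre.norm_nonneg b)) fun P => by
    rw [ev_add]
    exact (norm_add_le _ _).trans (add_le_add (P.norm_ev_le a) (P.norm_ev_le b))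
  norm_eq_zero_iff a := by
    constructor
    · intro h
      refine Pre.ext fun P => ?_
      have := P.norm_ev_le a
      rw [h] at this
      simpa using this
    · rintro rfl
      simp [Pre.norm_def]

noncomputable instance : NormedAddCommGroup (Pre L) := NormedAddCommGroup.ofCore Pre.core

noncomputable instance : NormedSpace ℝ (Pre L) := NormedSpace.ofCore Pre.core

instance : IsOrderedAddMonoid (Pre L) where
  add_le_add_left a b h c := Pre.le_iff.2 fun P => by
    simpa using Pre.le_iff.1 h P

instance : HasSolidNorm (Pre L) where
  solid a b h := Pre.norm_le (Pre.norm_nonneg b) fun P => by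
    refine (norm_le_norm_of_abs_le_abs ?_).trans (P.norm_ev_le b)
    simpa using Pre.le_iff.1 h P

theorem smul_sup_of_nonneg {X : Type u} [NormedAddCommGroup X] [NormedSpace ℝ X] [Lattice X]
    [IsOrderedAddMonoid X] [IsOrderedModule ℝ X] {r : ℝ} (hr : 0 ≤ r) (a b : X) :
    r • (a ⊔ b) = r • a ⊔ r • b := by
  rcases hr.eq_or_lt with rfl | hr
  · simp
  · exact (OrderIso.smulRight (β := X) hr).map_sup a b

/-! The lattice operations of the free normed vector lattice extend to its completion. -/

open UniformSpace

variable (L) in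
/-- The free Banach lattice generated by `L`. -/
abbrev FBL : Type u := Completion (Pre L)

theorem uniformContinuous_sup : UniformContinuous₂ fun a b : Pre L => a ⊔ b := by
  rw [UniformContinuous₂, Metric.uniformContinuous_iff]
  intro ε hε
  refine ⟨ε / 2, by positivity, ?_⟩
  rintro ⟨a, b⟩ ⟨c, d⟩ h
  have h1 : dist a c < ε / 2 := (le_max_left _ _).trans_lt h
  have h2 : dist b d < ε / 2 := (le_max_right _ _).trans_lt h
  rw [dist_eq_norm] at h1 h2
  have h3 : dist (a ⊔ b) (c ⊔ d) ≤ ‖a - c‖ + ‖b - d‖ := by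
    rw [dist_eq_norm]
    exact norm_sup_sub_sup_le_add_norm a b c d
  exact h3.trans_lt (by linarith)

/-- The supremum. -/
noncomputable def csup : FBL L → FBL L → FBL L := Completion.map₂ (· ⊔ ·)

/-- The infimum. -/
noncomputable def cinf (a b : FBL L) : FBL L := -csup (-a) (-b)

theorem coe_csup (a b : Pre L) : ((a ⊔ b : Pre L) : FBL L) = csup (a : FBL L) (b : FBL L) :=
  (Completion.map₂_coe_coe a b _ uniformContinuous_sup).symm

theorem coe_cinf (a b : Pre L) : ((a ⊓ b : Pre L) : FBL L) = cinf (a : FBL L) (b : FBL L) := by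
  rw [cinf, ← Completion.coe_neg, ← Completion.coe_neg, ← coe_csup, ← Completion.coe_neg]
  congr 1

theorem cont_csup {Z : Type*} [TopologicalSpace Z] {f g : Z → FBL L} (hf : Continuous f)
    (hg : Continuous g) : Continuous fun z => csup (f z) (g z) :=
  Completion.continuous_map₂ hf hg

theorem cont_cinf {Z : Type*} [TopologicalSpace Z] {f g : Z → FBL L} (hf : Continuous f)
    (hg : Continuous g) : Continuous fun z => cinf (f z) (g z) :=
  (cont_csup hf.neg hg.neg).neg

noncomputable instance : Lattice (FBL L) := latticeOfEq csup cinf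
  (fun a b => Completion.induction_on₂ a b
    (isClosed_eq (cont_csup continuous_fst continuous_snd)
      (cont_csup continuous_snd continuous_fst))
    fun a b => by rw [← coe_csup, ← coe_csup, sup_comm])
  (fun a b c => Completion.induction_on₃ a b c
    (isClosed_eq (cont_csup (cont_csup continuous_fst (by fun_prop)) (by fun_prop))
      (cont_csup continuous_fst (cont_csup (by fun_prop) (by fun_prop))))
    fun a b c => by rw [← coe_csup, ← coe_csup, ← coe_csup, ← coe_csup, sup_assoc])
  (fun a b => Completion.induction_on₂ a b
    (isClosed_eq (cont_cinf continuous_fst continuous_snd)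
      (cont_cinf continuous_snd continuous_fst))
    fun a b => by rw [← coe_cinf, ← coe_cinf, inf_comm])
  (fun a b c => Completion.induction_on₃ a b c
    (isClosed_eq (cont_cinf (cont_cinf continuous_fst (by fun_prop)) (by fun_prop))
      (cont_cinf continuous_fst (cont_cinf (by fun_prop) (by fun_prop))))
    fun a b c => by rw [← coe_cinf, ← coe_cinf, ← coe_cinf, ← coe_cinf, inf_assoc])
  (fun a b => Completion.induction_on₂ a b
    (isClosed_eq (cont_csup continuous_fst (cont_cinf continuous_fst continuous_snd))
      continuous_fst)
    fun a b => by rw [← coe_cinf, ← coe_csup, sup_inf_self])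
  (fun a b => Completion.induction_on₂ a b
    (isClosed_eq (cont_cinf continuous_fst (cont_csup continuous_fst continuous_snd))
      continuous_fst)
    fun a b => by rw [← coe_csup, ← coe_cinf, inf_sup_self])

theorem coe_sup (a b : Pre L) : ((a ⊔ b : Pre L) : FBL L) = (a : FBL L) ⊔ (b : FBL L) :=
  coe_csup a b

theorem coe_inf (a b : Pre L) : ((a ⊓ b : Pre L) : FBL L) = (a : FBL L) ⊓ (b : FBL L) :=
  coe_cinf a b

theorem cont_sup {Z : Type*} [TopologicalSpace Z] {f g : Z → FBL L} (hf : Continuous f)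
    (hg : Continuous g) : Continuous fun z => f z ⊔ g z :=
  cont_csup hf hg

theorem cont_inf {Z : Type*} [TopologicalSpace Z] {f g : Z → FBL L} (hf : Continuous f)
    (hg : Continuous g) : Continuous fun z => f z ⊓ g z :=
  cont_cinf hf hg

theorem add_sup' (a b c : FBL L) : (a ⊔ b) + c = (a + c) ⊔ (b + c) :=
  Completion.induction_on₃ a b c
    (isClosed_eq ((cont_sup (by fun_prop) (by fun_prop)).add (by fun_prop))
      (cont_sup (by fun_prop) (by fun_prop)))
    fun a b c => by
      rw [← coe_sup, ← Completion.coe_add, ← Completion.coe_add, ← Completion.coe_add, ← coe_sup,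
        sup_add]

instance : IsOrderedAddMonoid (FBL L) where
  add_le_add_left a b h c := by
    rw [← sup_eq_right] at h ⊢
    rw [← add_sup', h]

theorem smul_sup' {r : ℝ} (hr : 0 ≤ r) (a b : FBL L) : r • (a ⊔ b) = r • a ⊔ r • b := by
  have h1 : Continuous fun p : FBL L × FBL L => r • (p.1 ⊔ p.2) :=
    (cont_sup continuous_fst continuous_snd).const_smul r
  have h2 : Continuous fun p : FBL L × FBL L => r • p.1 ⊔ r • p.2 :=
    cont_sup (continuous_fst.const_smul r) (continuous_snd.const_smul r)
  refine Completion.induction_on₂ a b (isClosed_eq h1 h2) fun a b => ?_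
  have h3 : r • (a ⊔ b) = r • a ⊔ r • b :=
    Pre.ext fun P => by simp [smul_sup_of_nonneg hr]
  rw [← coe_sup, ← Completion.coe_smul, ← Completion.coe_smul, ← Completion.coe_smul, ← coe_sup,
    h3]

instance : IsOrderedModule ℝ (FBL L) where
  smul_le_smul_of_nonneg_left r hr a b h := by
    rw [← sup_eq_right] at h ⊢
    rw [← smul_sup' hr, h]
  smul_le_smul_of_nonneg_right a ha r s h := by
    have h1 : (s - r) • (0 : FBL L) ⊔ (s - r) • a = (s - r) • a := by
      rw [← smul_sup' (sub_nonneg.2 h), sup_eq_right.2 ha]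
    rw [sup_eq_right, smul_zero, sub_smul, sub_nonneg] at h1
    exact h1

theorem coe_abs (a : Pre L) : ((|a| : Pre L) : FBL L) = |(a : FBL L)| := by
  rw [abs, abs, coe_sup, Completion.coe_neg]

instance : HasSolidNorm (FBL L) where
  solid a b h := by
    have h1 : ‖|a|‖ = ‖a‖ := Completion.induction_on a
      (isClosed_eq (cont_sup continuous_id continuous_neg).norm continuous_norm)
      fun a => by rw [← coe_abs, Completion.norm_coe, Completion.norm_coe, norm_abs_eq_norm]
    have h2 : ‖|a| ⊓ |b|‖ ≤ ‖b‖ := Completion.induction_on₂ a b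
      (isClosed_le (cont_inf (cont_sup continuous_fst continuous_fst.neg)
        (cont_sup continuous_snd continuous_snd.neg)).norm continuous_snd.norm)
      fun a b => by
        rw [← coe_abs, ← coe_abs, ← coe_inf, Completion.norm_coe, Completion.norm_coe]
        refine norm_le_norm_of_abs_le_abs ?_
        rw [abs_of_nonneg (le_inf (abs_nonneg a) (abs_nonneg b))]
        exact inf_le_right
    rw [inf_eq_left.2 h, h1] at h2
    exact h2

instance : IsBanachLattice (FBL L) where
  isOrderedAddMonoid := inferInstance
  isOrderedModule := inferInstance
  hasSolidNorm := inferInstance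
  completeSpace := inferInstance

/-- The generators of the free normed vector lattice. -/
def Pre.of (x : L) : Pre L := Quotient.mk _ (.of x)

theorem ev_of (P : Test L) (x : L) : P.ev (Pre.of x) = P.T x := rfl

variable (L) in
/-- The canonical map from `L` to its free Banach lattice. -/
noncomputable def δ : LatticeHom L (FBL L) where
  toFun x := (Pre.of x : FBL L)
  map_sup' x y := by
    rw [← coe_sup]
    congr 1
    exact Pre.ext fun P => by simp [ev_of]
  map_inf' x y := by
    rw [← coe_inf]
    congr 1
    exact Pre.ext fun P => by simp [ev_of]

theorem δ_apply (x : L) : δ L x = (Pre.of x : FBL L) := rfl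

theorem norm_δ_le (x : L) : ‖δ L x‖ ≤ 1 := by
  rw [δ_apply, Completion.norm_coe]
  exact Pre.norm_le zero_le_one fun P => P.le_one x

/-- The bounded operator on the free normed vector lattice given by a test. -/
noncomputable def Test.evL (P : Test L) : Pre L →L[ℝ] P.X :=
  LinearMap.mkContinuous ⟨⟨P.ev, ev_add P⟩, ev_smul P⟩ 1 fun a => by
    simpa using P.norm_ev_le a

theorem Test.evL_apply (P : Test L) (a : Pre L) : P.evL a = P.ev a := rfl

/-- The bounded operator on the free Banach lattice given by a test. -/
noncomputable def Test.lift (P : Test L) : FBL L →L[ℝ] P.X :=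
  P.evL.extend (Completion.toComplL : Pre L →L[ℝ] FBL L)

theorem Test.lift_coe (P : Test L) (a : Pre L) : P.lift (a : FBL L) = P.ev a :=
  P.evL.extend_eq Completion.denseRange_coe (Completion.isUniformInducing_coe _) a

theorem Test.norm_lift_le (P : Test L) : ‖P.lift‖ ≤ 1 := by
  refine ContinuousLinearMap.opNorm_le_bound _ zero_le_one fun a => ?_
  refine Completion.induction_on a (isClosed_le (by fun_prop) (by fun_prop)) fun a => ?_
  rw [P.lift_coe, one_mul, Completion.norm_coe]
  exact P.norm_ev_le a

theorem Test.lift_sup (P : Test L) (a b : FBL L) : P.lift (a ⊔ b) = P.lift a ⊔ P.lift b :=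
  Completion.induction_on₂ a b
    (isClosed_eq (P.lift.continuous.comp (cont_sup continuous_fst continuous_snd))
      ((P.lift.continuous.comp continuous_fst).sup (P.lift.continuous.comp continuous_snd)))
    fun a b => by rw [← coe_sup, P.lift_coe, P.lift_coe, P.lift_coe, ev_sup]

theorem Test.lift_inf (P : Test L) (a b : FBL L) : P.lift (a ⊓ b) = P.lift a ⊓ P.lift b := by
  rw [← neg_neg (a ⊓ b), neg_inf, map_neg, P.lift_sup, map_neg, map_neg, neg_sup, neg_neg, neg_neg]

/-- Two bounded lattice homomorphisms which agree on the generators are equal. -/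
theorem lift_unique {X : Type u} [NormedAddCommGroup X] [NormedSpace ℝ X] [Lattice X]
    (S S' : BanachLatticeHom (FBL L) X) (h : ∀ x, S (δ L x) = S' (δ L x)) : S = S' := by
  have key : ∀ t : Term L, S ((Pre.mk t : Pre L) : FBL L) =
      S' ((Pre.mk t : Pre L) : FBL L) := by
    intro t
    induction t with
    | of x => exact h x
    | zero =>
      change S.toCLM ((0 : Pre L) : FBL L) = S'.toCLM ((0 : Pre L) : FBL L)
      rw [Completion.coe_zero, map_zero, map_zero]
    | add a b ha hb =>
      change S.toCLM ((Pre.mk a + Pre.mk b : Pre L) : FBL L) =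
        S'.toCLM ((Pre.mk a + Pre.mk b : Pre L) : FBL L)
      rw [Completion.coe_add, map_add, map_add, ha, hb]
    | smul r a ha =>
      change S.toCLM ((r • Pre.mk a : Pre L) : FBL L) =
        S'.toCLM ((r • Pre.mk a : Pre L) : FBL L)
      rw [Completion.coe_smul, map_smul, map_smul, ha]
    | sup a b ha hb =>
      change S.toCLM ((Pre.mk a ⊔ Pre.mk b : Pre L) : FBL L) =
        S'.toCLM ((Pre.mk a ⊔ Pre.mk b : Pre L) : FBL L)
      rw [coe_sup, S.map_sup, S'.map_sup, ha, hb]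
  have : S.toCLM = S'.toCLM := by
    ext a
    refine Completion.induction_on a
      (isClosed_eq S.toCLM.continuous S'.toCLM.continuous) fun a => ?_
    induction a using Quotient.inductionOn with | _ t
    exact key t
  cases S
  cases S'
  simp_all

variable (L) in
/-- Every lattice generates a free Banach lattice. -/
theorem isFreeBanachLattice : IsFreeBanachLattice L (FBL L) (δ L) where
  normBounded := ⟨1, by rintro _ ⟨x, rfl⟩; exact norm_δ_le x⟩
  existsUnique_lift X _ _ _ _ T hT := by
    have hx : ∀ x, ‖T x‖ ≤ supNorm T := fun x => le_ciSup hT x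
    have h0 : 0 ≤ supNorm T := Real.iSup_nonneg fun _ => norm_nonneg _
    suffices h : ∃ T' : BanachLatticeHom (FBL L) X, (∀ x, T' (δ L x) = T x) ∧
        ‖T'.toCLM‖ ≤ supNorm T by
      obtain ⟨T', h1, h2⟩ := h
      refine ⟨T', h1, le_antisymm h2 (Real.iSup_le (fun x => ?_) (norm_nonneg _)), fun S hS =>
        lift_unique S T' fun x => (hS x).trans (h1 x).symm⟩
      rw [← h1 x]
      exact T'.toCLM.le_of_opNorm_le_of_le le_rfl (norm_δ_le x) |>.trans_eq (mul_one _)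
    rcases h0.eq_or_lt with h0 | h0
    · have hT0 : ∀ x, T x = 0 := fun x => by
        have := hx x
        rw [← h0] at this
        simpa using this
      exact ⟨⟨0, fun _ _ => by simp, fun _ _ => by simp⟩, fun x => by simp [hT0], by simp [← h0]⟩
    · have hi : 0 ≤ (supNorm T)⁻¹ := inv_nonneg.2 h0.le
      let P : Test L :=
        { X := X
          T :=
            { toFun := fun x => (supNorm T)⁻¹ • T x
              map_sup' := fun x y => by rw [map_sup, smul_sup_of_nonneg hi]
              map_inf' := fun x y => by
                rw [map_inf, ← neg_neg (T x ⊓ T y), neg_inf, smul_neg, smul_sup_of_nonneg hi,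
                  smul_neg, smul_neg, neg_sup, neg_neg, neg_neg] }
          le_one := fun x => by
            change ‖(supNorm T)⁻¹ • T x‖ ≤ 1
            rw [norm_smul, Real.norm_of_nonneg hi, inv_mul_le_one₀ h0]
            exact hx x }
      refine ⟨⟨supNorm T • P.lift, fun a b => ?_, fun a b => ?_⟩, fun x => ?_, ?_⟩
      · change supNorm T • P.lift (a ⊔ b) = supNorm T • P.lift a ⊔ supNorm T • P.lift b
        rw [P.lift_sup, smul_sup_of_nonneg h0.le]
      · change supNorm T • P.lift (a ⊓ b) = supNorm T • P.lift a ⊓ supNorm T • P.lift b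
        rw [P.lift_inf, ← neg_neg (P.lift a ⊓ P.lift b), neg_inf, smul_neg,
          smul_sup_of_nonneg h0.le, smul_neg, smul_neg, neg_sup, neg_neg, neg_neg]
      · change supNorm T • P.lift ((Pre.of x : Pre L) : FBL L) = T x
        rw [P.lift_coe, ev_of]
        exact smul_inv_smul₀ h0.ne' _
      · change ‖supNorm T • P.lift‖ ≤ supNorm T
        rw [norm_smul, Real.norm_of_nonneg h0.le]
        exact mul_le_of_le_one_right h0.le P.norm_lift_le

end FreeBanachLattice

/-! ### Disjointness in vector lattices and ultrafilters of positive elements. -/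

section Disjointness

variable {X : Type*} [AddCommGroup X] [Lattice X]

/-! The proof rests on an equivalent description of the norm: for `f` in a free Banach lattice, the
supremum of `‖hF.evalHom z f‖` over lattice homomorphisms `z` to `[-1, 1]` is at most `‖f‖`, and
`‖f‖` is at most twice that supremum (`norm_le_two_mul`). Given this, 3 implies 1 with `c = 1 / 2`:
evaluating `f` at `y` is evaluating its image at an extension of `y`.

The upper estimate reduces by density to vector lattice terms. Suppose `t` has absolute value at
most `s` under every `z`, while its value under some `T` with `|T x| ≤ e` is not dominated by `s •
e`. An ultrafilter of positive elements, chosen where the domination fails, makes the order total.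
The standard parts of the quotients `T x / e` then form a homomorphism `z` to `[-1, 1]` under which
`t` exceeds `s` in absolute value, a contradiction (`abs_evalWith_le`). A common `e` need not exist,
but a term has finitely many variables, lying in some interval `[a, b]`. Truncating `T` at `|T a| +
|T b|`, an element of norm at most 2, changes nothing there; this is the source of the factor 2.

For 2 implies 3, elements of a free Banach lattice act on homomorphisms as positively homogeneous
functions, so they can only single out the ray through `y`. If `y` does not extend, compactness
gives a finite set and an `ε` such that no restriction from `M` is `ε`-close to `y` on that set. A
bump around the ray through `y` then vanishes at every restriction, since a positive multiple of a
homomorphism near the ray, clipped to `[-1, 1]`, would be close to `y`. Its image is therefore zero,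
although its value at `y` is positive, which contradicts injectivity. -/

theorem inf_eq_zero_of_le {p q v : X} (hp : 0 ≤ p) (h : p ≤ q) (hqv : q ⊓ v = 0) : p ⊓ v = 0 :=
  le_antisymm (hqv ▸ inf_le_inf_right v h) (le_inf hp (hqv ▸ inf_le_right))

/-- The ultrafilters of the lattice of positive elements of a vector lattice. -/
structure IsPosUltrafilter (U : Set X) : Prop where
  nonneg : ∀ v ∈ U, 0 ≤ v
  zero_notMem : (0 : X) ∉ U
  nonempty : U.Nonempty
  inf_mem : ∀ v ∈ U, ∀ w ∈ U, v ⊓ w ∈ U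
  mem_of_inf_ne_zero : ∀ b : X, 0 ≤ b → (∀ v ∈ U, b ⊓ v ≠ 0) → b ∈ U

/-- Zorn's lemma for sets of positive elements that are closed under `⊓` and omit `0`. If `b` meets
every member of a maximal `U` nontrivially, adjoining `b` and all `b ⊓ v` gives another such set, so
`b` is already in `U`. -/
theorem exists_isPosUltrafilter {w : X} (hw : 0 ≤ w) (hw0 : w ≠ 0) :
    ∃ U : Set X, IsPosUltrafilter U ∧ w ∈ U := by
  let S : Set (Set X) := {U | (∀ v ∈ U, 0 ≤ v) ∧ (0 : X) ∉ U ∧ ∀ v ∈ U, ∀ w ∈ U, v ⊓ w ∈ U}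
  obtain ⟨U, hwU, hU⟩ := zorn_subset_nonempty S (by
    intro c hc hchain hne
    refine ⟨⋃₀ c, ⟨?_, ?_, ?_⟩, fun s hs => Set.subset_sUnion_of_mem hs⟩
    · rintro v ⟨s, hs, hv⟩
      exact (hc hs).1 v hv
    · rintro ⟨s, hs, hv⟩
      exact (hc hs).2.1 hv
    · rintro v ⟨s, hs, hv⟩ w ⟨t, ht, hw⟩
      rcases hchain.total hs ht with h | h
      · exact ⟨t, ht, (hc ht).2.2 v (h hv) w hw⟩
      · exact ⟨s, hs, (hc hs).2.2 v hv w (h hw)⟩) {w} (by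
    refine ⟨?_, ?_, ?_⟩
    · rintro v rfl
      exact hw
    · exact fun h => hw0 (Set.mem_singleton_iff.1 h).symm
    · rintro v rfl w rfl
      simp)
  obtain ⟨h1, h2, h3⟩ := hU.prop
  refine ⟨U, ⟨h1, h2, ⟨w, hwU rfl⟩, h3, fun b hb hbU => ?_⟩, hwU rfl⟩
  have hV : insert b (U ∪ (fun v => b ⊓ v) '' U) ∈ S := by
    refine ⟨?_, ?_, ?_⟩
    · rintro v (rfl | hv | ⟨v, hv, rfl⟩)
      · exact hb
      · exact h1 v hv
      · exact le_inf hb (h1 v hv)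
    · rintro (h | h | ⟨v, hv, h⟩)
      · refine hbU w (hwU rfl) ?_
        rw [← h]
        exact inf_eq_left.2 hw
      · exact h2 h
      · exact hbU v hv h
    · rintro v (rfl | hv | ⟨v, hv, rfl⟩) w (rfl | hw | ⟨w, hw, rfl⟩)
      · exact Or.inl (inf_idem _)
      · exact Or.inr (Or.inr ⟨w, hw, rfl⟩)
      · exact Or.inr (Or.inr ⟨w, hw, by simp⟩)
      · exact Or.inr (Or.inr ⟨v, hv, inf_comm _ _⟩)
      · exact Or.inr (Or.inl (h3 v hv w hw))
      · exact Or.inr (Or.inr ⟨v ⊓ w, h3 v hv w hw, by simp only; ac_rfl⟩)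
      · exact Or.inr (Or.inr ⟨v, hv, by simp only; rw [inf_right_comm, inf_idem]⟩)
      · exact Or.inr (Or.inr ⟨v ⊓ w, h3 v hv w hw, by simp only; ac_rfl⟩)
      · exact Or.inr (Or.inr ⟨v ⊓ w, h3 v hv w hw, by simp only; rw [inf_inf_distrib_left]⟩)
  exact hU.le_of_ge hV ((Set.subset_union_left).trans (Set.subset_insert _ _)) (Set.mem_insert _ _)

/-- `a` is at most `b` near the ultrafilter `U`. -/
def LEMod (U : Set X) (a b : X) : Prop := ∃ v ∈ U, (a - b)⁺ ⊓ v = 0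

namespace IsPosUltrafilter

variable {U : Set X}

/-- The relation depends only on the difference of its arguments; this lets later inequalities be
rearranged by `abel` or `module`. -/
theorem leMod_congr_sub {a b c d : X} (h : LEMod U a b) (e : a - b = c - d) : LEMod U c d := by
  obtain ⟨v, hv, h⟩ := h
  exact ⟨v, hv, e ▸ h⟩

theorem not_leMod_zero_of_mem (hU : IsPosUltrafilter U) {w : X} (hw : w ∈ U) : ¬ LEMod U w 0 := by
  rintro ⟨v, hv, h⟩
  rw [sub_zero, posPart_of_nonneg (hU.nonneg w hw)] at h
  exact hU.zero_notMem (h ▸ hU.inf_mem w hw v hv)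

end IsPosUltrafilter

variable [IsOrderedAddMonoid X]

/-- Subtracting `p` from `(p + q) ⊓ v` leaves something below `q ⊓ v = 0`, so `(p + q) ⊓ v` lies
below both `p` and `v`. -/
theorem add_inf_eq_zero {p q v : X} (hp : 0 ≤ p) (hq : 0 ≤ q) (hpv : p ⊓ v = 0)
    (hqv : q ⊓ v = 0) : (p + q) ⊓ v = 0 := by
  have hv : 0 ≤ v := hpv ▸ inf_le_right
  refine le_antisymm ?_ (le_inf (add_nonneg hp hq) hv)
  have h1 : (p + q) ⊓ v - p ≤ q ⊓ v := by
    refine le_inf ?_ ?_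
    · rw [sub_le_iff_le_add']
      exact inf_le_left
    · exact (sub_le_self _ hp).trans inf_le_right
  rw [hqv, sub_nonpos] at h1
  exact hpv ▸ le_inf h1 inf_le_right

theorem nsmul_inf_eq_zero {p v : X} (hp : 0 ≤ p) (hpv : p ⊓ v = 0) (n : ℕ) : (n • p) ⊓ v = 0 := by
  induction n with
  | zero => simpa using (hpv ▸ inf_le_right : (0 : X) ≤ v)
  | succ n ih =>
    rw [succ_nsmul]
    exact add_inf_eq_zero (nsmul_nonneg hp n) hp ih hpv

theorem smul_inf_eq_zero [Module ℝ X] [IsOrderedModule ℝ X] {p v : X} {c : ℝ} (hc : 0 ≤ c)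
    (hp : 0 ≤ p) (hpv : p ⊓ v = 0) : (c • p) ⊓ v = 0 := by
  obtain ⟨n, hn⟩ := exists_nat_ge c
  refine inf_eq_zero_of_le (smul_nonneg hc hp) (q := n • p) ?_ (nsmul_inf_eq_zero hp hpv n)
  rw [← Nat.cast_smul_eq_nsmul ℝ]
  exact smul_le_smul_of_nonneg_right hn hp

theorem inf_sup_eq_zero {p q v : X} (hpv : p ⊓ v = 0) (hqv : q ⊓ v = 0) : (p ⊔ q) ⊓ v = 0 := by
  have hp : 0 ≤ p := hpv ▸ inf_le_left
  have hq : 0 ≤ q := hqv ▸ inf_le_left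
  exact inf_eq_zero_of_le (hp.trans le_sup_left)
    (sup_le (le_add_of_nonneg_right hq) (le_add_of_nonneg_left hp)) (add_inf_eq_zero hp hq hpv hqv)

namespace IsPosUltrafilter

variable {U : Set X}

theorem leMod_of_le (hU : IsPosUltrafilter U) {a b : X} (h : a ≤ b) : LEMod U a b := by
  obtain ⟨v, hv⟩ := hU.nonempty
  refine ⟨v, hv, ?_⟩
  rw [posPart_eq_zero.2 (sub_nonpos.2 h)]
  exact inf_eq_left.2 (hU.nonneg v hv)

theorem leMod_add (hU : IsPosUltrafilter U) {a b c d : X} (h : LEMod U a b) (k : LEMod U c d) :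
    LEMod U (a + c) (b + d) := by
  obtain ⟨v, hv, h⟩ := h
  obtain ⟨w, hw, k⟩ := k
  have hz := hU.nonneg _ (hU.inf_mem v hv w hw)
  refine ⟨v ⊓ w, hU.inf_mem v hv w hw, ?_⟩
  refine inf_eq_zero_of_le (posPart_nonneg _) (q := (a - b)⁺ + (c - d)⁺) ?_ ?_
  · rw [add_sub_add_comm]
    exact sup_le (add_le_add (le_posPart _) (le_posPart _))
      (add_nonneg (posPart_nonneg _) (posPart_nonneg _))
  · refine add_inf_eq_zero (posPart_nonneg _) (posPart_nonneg _) ?_ ?_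
    · exact le_antisymm (h ▸ inf_le_inf_left _ inf_le_left) (le_inf (posPart_nonneg _) hz)
    · exact le_antisymm (k ▸ inf_le_inf_left _ inf_le_right) (le_inf (posPart_nonneg _) hz)

theorem leMod_trans (hU : IsPosUltrafilter U) {a b c : X} (h : LEMod U a b) (k : LEMod U b c) :
    LEMod U a c :=
  leMod_congr_sub (hU.leMod_add h k) (by abel)

theorem leMod_smul [Module ℝ X] [IsOrderedModule ℝ X] {a b : X} (h : LEMod U a b) {c : ℝ}
    (hc : 0 ≤ c) : LEMod U (c • a) (c • b) := by
  obtain ⟨v, hv, h⟩ := h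
  refine ⟨v, hv, ?_⟩
  refine inf_eq_zero_of_le (posPart_nonneg _) (q := c • (a - b)⁺) ?_
    (smul_inf_eq_zero hc (posPart_nonneg _) h)
  rw [← smul_sub]
  exact sup_le (smul_le_smul_of_nonneg_left (le_posPart _) hc) (smul_nonneg hc (posPart_nonneg _))

theorem sup_leMod (hU : IsPosUltrafilter U) {a b c : X} (h : LEMod U a c) (k : LEMod U b c) :
    LEMod U (a ⊔ b) c := by
  obtain ⟨v, hv, h⟩ := h
  obtain ⟨w, hw, k⟩ := k
  have hz := hU.nonneg _ (hU.inf_mem v hv w hw)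
  refine ⟨v ⊓ w, hU.inf_mem v hv w hw, ?_⟩
  have e : (a ⊔ b - c)⁺ = (a - c)⁺ ⊔ (b - c)⁺ := by
    simp only [sub_eq_add_neg, sup_add, posPart_def]
    rw [sup_sup_distrib_right]
  rw [e]
  refine inf_sup_eq_zero ?_ ?_
  · exact le_antisymm (h ▸ inf_le_inf_left _ inf_le_left) (le_inf (posPart_nonneg _) hz)
  · exact le_antisymm (k ▸ inf_le_inf_left _ inf_le_right) (le_inf (posPart_nonneg _) hz)

/-- The positive and negative parts of `a - b` are disjoint. If the positive part is in `U`, it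
witnesses one direction; if not, the ultrafilter property supplies a member of `U` disjoint from it,
which witnesses the other. -/
theorem leMod_total (hU : IsPosUltrafilter U) (a b : X) : LEMod U a b ∨ LEMod U b a := by
  by_cases h : (a - b)⁺ ∈ U
  · refine Or.inr ⟨_, h, ?_⟩
    rw [← neg_sub a b, posPart_neg, inf_comm]
    exact posPart_inf_negPart_eq_zero _
  · left
    by_contra k
    exact h (hU.mem_of_inf_ne_zero _ (posPart_nonneg _) fun v hv e => k ⟨v, hv, e⟩)

end IsPosUltrafilter

end Disjointness

/-! ### Standard parts of quotients at an ultrafilter. -/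

section StandardPart

variable {X : Type*} [AddCommGroup X] [Lattice X] [Module ℝ X]

/-- The real number `r` is the value of `a / e` at the ultrafilter `U`. -/
def IsValueMod (U : Set X) (e a : X) (r : ℝ) : Prop :=
  ∀ ε > 0, LEMod U ((r - ε) • e) a ∧ LEMod U a ((r + ε) • e)

/-- The value of `a / e` at the ultrafilter `U`, truncated to `[-1, 1]`. -/
noncomputable def valueMod (U : Set X) (e a : X) : ℝ :=
  sSup {r | r ∈ Set.Icc (-1 : ℝ) 1 ∧ LEMod U (r • e) a}

namespace IsPosUltrafilter

variable {U : Set X} {e a b : X} {r q : ℝ}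

theorem isValueMod_neg (ha : IsValueMod U e a r) : IsValueMod U e (-a) (-r) := fun ε hε => by
  obtain ⟨h1, h2⟩ := ha ε hε
  exact ⟨leMod_congr_sub h2 (by module), leMod_congr_sub h1 (by module)⟩

variable [IsOrderedAddMonoid X]

theorem isValueMod_zero (hU : IsPosUltrafilter U) [IsOrderedModule ℝ X] (he : 0 ≤ e) :
    IsValueMod U e 0 0 := fun ε hε =>
  ⟨hU.leMod_of_le (by
    rw [zero_sub, neg_smul, neg_nonpos]
    exact smul_nonneg hε.le he), hU.leMod_of_le (smul_nonneg (by linarith) he)⟩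

theorem isValueMod_add (hU : IsPosUltrafilter U) (ha : IsValueMod U e a r)
    (hb : IsValueMod U e b q) : IsValueMod U e (a + b) (r + q) := fun ε hε => by
  obtain ⟨h1, h2⟩ := ha (ε / 2) (half_pos hε)
  obtain ⟨k1, k2⟩ := hb (ε / 2) (half_pos hε)
  exact ⟨leMod_congr_sub (hU.leMod_add h1 k1) (by module),
    leMod_congr_sub (hU.leMod_add h2 k2) (by module)⟩

variable [IsOrderedModule ℝ X]

theorem isValueMod_smul_of_nonneg (hU : IsPosUltrafilter U) (he : 0 ≤ e)
    (ha : IsValueMod U e a r) {c : ℝ} (hc : 0 ≤ c) : IsValueMod U e (c • a) (c * r) := by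
  rcases hc.eq_or_lt with rfl | hc
  · simpa using hU.isValueMod_zero he
  · intro ε hε
    obtain ⟨h1, h2⟩ := ha (ε / c) (div_pos hε hc)
    have e1 : c * (ε / c) = ε := by field_simp
    have k1 := leMod_smul h1 hc.le
    have k2 := leMod_smul h2 hc.le
    rw [smul_smul, mul_sub, e1] at k1
    rw [smul_smul, mul_add, e1] at k2
    exact ⟨k1, k2⟩

theorem isValueMod_smul (hU : IsPosUltrafilter U) (he : 0 ≤ e)
    (ha : IsValueMod U e a r) (c : ℝ) : IsValueMod U e (c • a) (c * r) := by
  rcases le_total 0 c with hc | hc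
  · exact hU.isValueMod_smul_of_nonneg he ha hc
  · have := isValueMod_neg (hU.isValueMod_smul_of_nonneg he ha (neg_nonneg.2 hc))
    simpa using this

theorem isValueMod_sup (hU : IsPosUltrafilter U) (he : 0 ≤ e) (ha : IsValueMod U e a r)
    (hb : IsValueMod U e b q) : IsValueMod U e (a ⊔ b) (r ⊔ q) := fun ε hε => by
  obtain ⟨h1, h2⟩ := ha ε hε
  obtain ⟨k1, k2⟩ := hb ε hε
  refine ⟨?_, hU.sup_leMod (hU.leMod_trans h2 (hU.leMod_of_le ?_))
    (hU.leMod_trans k2 (hU.leMod_of_le ?_))⟩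
  · rcases le_total r q with h | h
    · rw [sup_eq_right.2 h]
      exact hU.leMod_trans k1 (hU.leMod_of_le le_sup_right)
    · rw [sup_eq_left.2 h]
      exact hU.leMod_trans h1 (hU.leMod_of_le le_sup_left)
  · exact smul_le_smul_of_nonneg_right (by gcongr; exact le_sup_left) he
  · exact smul_le_smul_of_nonneg_right (by gcongr; exact le_sup_right) he

theorem isValueMod_inf (hU : IsPosUltrafilter U) (he : 0 ≤ e) (ha : IsValueMod U e a r)
    (hb : IsValueMod U e b q) : IsValueMod U e (a ⊓ b) (r ⊓ q) := by
  have := isValueMod_neg (hU.isValueMod_sup he (isValueMod_neg ha) (isValueMod_neg hb))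
  simpa [neg_sup] using this

theorem le_of_isValueMod (hU : IsPosUltrafilter U) (he0 : ¬ LEMod U e 0)
    (ha : IsValueMod U e a r) (hb : IsValueMod U e b q) (h : LEMod U a b) : r ≤ q := by
  by_contra! hlt
  -- With a third of the gap as error on each side, a third remains: `(r - q) / 3 • e` is
  -- negligible, hence so is `e`.
  have hd : 0 < (r - q) / 3 := by linarith
  have h1 := hU.leMod_trans (hU.leMod_trans (ha _ hd).1 h) (hb _ hd).2
  have h2 : LEMod U (((r - q) / 3) • e) 0 := leMod_congr_sub h1 (by module)
  have h3 := leMod_smul h2 (inv_nonneg.2 hd.le)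
  rw [inv_smul_smul₀ hd.ne', smul_zero] at h3
  exact he0 h3

theorem isValueMod_unique (hU : IsPosUltrafilter U) (he0 : ¬ LEMod U e 0)
    (ha : IsValueMod U e a r) (hb : IsValueMod U e a q) : r = q :=
  le_antisymm (hU.le_of_isValueMod he0 ha hb (hU.leMod_of_le le_rfl))
    (hU.le_of_isValueMod he0 hb ha (hU.leMod_of_le le_rfl))

/-- The value is a Dedekind cut. The lower estimate comes from the supremum and the upper one from
totality, as a larger multiple of `e` below `a` would belong to the cut. -/
theorem valueMod_spec (hU : IsPosUltrafilter U) (he : 0 ≤ e) (h : |a| ≤ e) :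
    valueMod U e a ∈ Set.Icc (-1 : ℝ) 1 ∧ IsValueMod U e a (valueMod U e a) := by
  obtain ⟨h1, h2⟩ := abs_le'.1 h
  have hm : (-1 : ℝ) ∈ {r | r ∈ Set.Icc (-1 : ℝ) 1 ∧ LEMod U (r • e) a} :=
    ⟨by simp, hU.leMod_of_le (by simpa using neg_le.1 h2)⟩
  have hb : BddAbove {r | r ∈ Set.Icc (-1 : ℝ) 1 ∧ LEMod U (r • e) a} := ⟨1, fun r hr => hr.1.2⟩
  have hge : -1 ≤ valueMod U e a := le_csSup hb hm
  refine ⟨⟨hge, csSup_le ⟨_, hm⟩ fun r hr => hr.1.2⟩, fun ε hε => ⟨?_, ?_⟩⟩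
  · obtain ⟨r, hr, hlt⟩ := exists_lt_of_lt_csSup ⟨_, hm⟩ (sub_lt_self (valueMod U e a) hε)
    exact hU.leMod_trans (hU.leMod_of_le (smul_le_smul_of_nonneg_right hlt.le he)) hr.2
  -- The cut only sees numbers up to 1; beyond that `a ≤ e` gives the estimate directly.
  · rcases le_total 1 (valueMod U e a + ε) with k | k
    · refine hU.leMod_of_le (h1.trans ?_)
      simpa using smul_le_smul_of_nonneg_right k he
    · refine (hU.leMod_total _ _).resolve_right fun k2 => ?_
      have : valueMod U e a + ε ≤ valueMod U e a := le_csSup hb ⟨⟨by linarith, k⟩, k2⟩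
      linarith

end IsPosUltrafilter

end StandardPart

namespace LatticeHom

/-- The lattice homomorphism to `[-1, 1]` given by a map to the reals. -/
def mkIcc {L : Type*} [Lattice L] (f : L → ℝ) (hf : ∀ x, f x ∈ Set.Icc (-1 : ℝ) 1)
    (hsup : ∀ x y, f (x ⊔ y) = f x ⊔ f y) (hinf : ∀ x y, f (x ⊓ y) = f x ⊓ f y) :
    LatticeHom L (Set.Icc (-1 : ℝ) 1) where
  toFun x := ⟨f x, hf x⟩
  map_sup' x y := Subtype.ext (hsup x y)
  map_inf' x y := Subtype.ext (hinf x y)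

end LatticeHom

/-! ### Evaluation of vector lattice terms. -/

namespace FreeBanachLattice

namespace Term

/-- The value of a vector lattice term under an assignment of its variables. -/
def evalWith {L X : Type*} [Add X] [Zero X] [SMul ℝ X] [Max X] (v : L → X) : Term L → X
  | .of x => v x
  | .zero => 0
  | .add a b => a.evalWith v + b.evalWith v
  | .smul r a => r • a.evalWith v
  | .sup a b => a.evalWith v ⊔ b.evalWith v

/-- All variables of a term lie between `a` and `b`. -/
def VarsIn {L : Type*} [LE L] (a b : L) : Term L → Prop
  | .of x => a ≤ x ∧ x ≤ b
  | .zero => True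
  | .add s t => s.VarsIn a b ∧ t.VarsIn a b
  | .smul _ s => s.VarsIn a b
  | .sup s t => s.VarsIn a b ∧ t.VarsIn a b

theorem VarsIn.mono {L : Type*} [Preorder L] {a b c d : L} (h : a ≤ c) (k : d ≤ b) {t : Term L}
    (ht : t.VarsIn c d) : t.VarsIn a b := by
  induction t with
  | of x => exact ⟨h.trans ht.1, ht.2.trans k⟩
  | zero => trivial
  | add s t hs ht' => exact ⟨hs ht.1, ht' ht.2⟩
  | smul r s hs => exact hs ht
  | sup s t hs ht' => exact ⟨hs ht.1, ht' ht.2⟩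

theorem exists_varsIn {L : Type*} [Lattice L] [Nonempty L] (t : Term L) :
    ∃ a b, t.VarsIn a b := by
  induction t with
  | of x => exact ⟨x, x, le_rfl, le_rfl⟩
  | zero => exact ⟨Classical.arbitrary L, Classical.arbitrary L, trivial⟩
  | smul r s hs => exact hs
  | add s t hs ht | sup s t hs ht =>
    obtain ⟨a, b, h⟩ := hs
    obtain ⟨c, d, k⟩ := ht
    exact ⟨a ⊓ c, b ⊔ d, h.mono inf_le_left le_sup_left, k.mono inf_le_right le_sup_right⟩

theorem evalWith_congr {L X : Type*} [LE L] [Add X] [Zero X] [SMul ℝ X] [Max X] {v w : L → X}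
    {a b : L} (h : ∀ x, a ≤ x → x ≤ b → v x = w x) {t : Term L} (ht : t.VarsIn a b) :
    t.evalWith v = t.evalWith w := by
  induction t with
  | of x => exact h x ht.1 ht.2
  | zero => rfl
  | add s t hs ht' => simp only [evalWith, hs ht.1, ht' ht.2]
  | smul r s hs => simp only [evalWith, hs ht]
  | sup s t hs ht' => simp only [evalWith, hs ht.1, ht' ht.2]

end Term

/-! ### Domination of terms by their values in `[-1, 1]`. -/

section Domination

/-- Term values stay in the ideal generated by `e`. Thus an ultrafilter that sees a nonzero term
value also sees `e`, which makes division by `e` meaningful. -/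
theorem abs_evalWith_le_bound {L X : Type*} [AddCommGroup X] [Lattice X] [IsOrderedAddMonoid X]
    [Module ℝ X] [IsOrderedModule ℝ X] {v : L → X} {e : X} (h : ∀ x, |v x| ≤ e)
    (t : Term L) : |t.evalWith v| ≤ bound t • e := by
  induction t with
  | of x => simpa [Term.evalWith, bound] using h x
  | zero => simp [Term.evalWith, bound]
  | add a b ha hb =>
    simp only [Term.evalWith, bound, add_smul]
    exact (abs_add_le _ _).trans (add_le_add ha hb)
  | smul r a ha =>
    simp only [Term.evalWith, bound, mul_smul]
    have h1 := smul_le_smul_of_nonneg_left ha (abs_nonneg r)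
    have h2 : ∀ c : X, |r| • c ≤ |r| • |c| := fun c =>
      smul_le_smul_of_nonneg_left (le_abs_self c) (abs_nonneg r)
    refine (abs_le'.2 ?_).trans h1
    rcases abs_choice r with hr | hr
    · refine ⟨by simpa [hr] using h2 (a.evalWith v), by simpa [hr] using h2 (-a.evalWith v)⟩
    · refine ⟨by simpa [hr] using h2 (-a.evalWith v), by simpa [hr] using h2 (a.evalWith v)⟩
  | sup a b ha hb =>
    simp only [Term.evalWith, bound, add_smul]
    have ha0 := (abs_nonneg _).trans ha
    have hb0 := (abs_nonneg _).trans hb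
    rw [abs_le'] at ha hb ⊢
    refine ⟨sup_le (ha.1.trans (le_add_of_nonneg_right hb0))
      (hb.1.trans (le_add_of_nonneg_left ha0)), ?_⟩
    rw [neg_sup]
    exact inf_le_left.trans (ha.2.trans (le_add_of_nonneg_right hb0))

theorem isValueMod_evalWith {L X : Type*} [AddCommGroup X] [Lattice X] [IsOrderedAddMonoid X]
    [Module ℝ X] [IsOrderedModule ℝ X] {U : Set X} (hU : IsPosUltrafilter U) {v : L → X}
    {z : L → ℝ} {e : X} (he : 0 ≤ e) (h : ∀ x, IsValueMod U e (v x) (z x)) (t : Term L) :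
    IsValueMod U e (t.evalWith v) (t.evalWith z) := by
  induction t with
  | of x => exact h x
  | zero => exact hU.isValueMod_zero he
  | add a b ha hb => exact hU.isValueMod_add ha hb
  | smul r a ha => exact hU.isValueMod_smul he ha r
  | sup a b ha hb => exact hU.isValueMod_sup he ha hb

variable {L X : Type*} [Lattice L] [NormedAddCommGroup X] [NormedSpace ℝ X] [Lattice X] [IsOrderedAddMonoid X]
  [IsOrderedModule ℝ X] [HasSolidNorm X]

/-- Lattice homomorphisms to `[-1, 1]` control the values of terms in all normed vector
lattices, relative to an element which dominates the generators. -/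
theorem abs_evalWith_le (T : LatticeHom L X) {e : X} (he : 0 ≤ e) (hT : ∀ x, |T x| ≤ e)
    (t : Term L) {s : ℝ} (hs : 0 ≤ s)
    (h : ∀ z : LatticeHom L (Set.Icc (-1 : ℝ) 1), |t.evalWith fun x => (z x : ℝ)| ≤ s) :
    |t.evalWith T| ≤ s • e := by
  -- The slack `ε` provides the strict inequality between real numbers at the end; it is removed
  -- because the order is closed in the norm.
  suffices key : ∀ ε > 0, |t.evalWith T| ≤ (s + ε) • e by
    have h1 : Filter.Tendsto (fun ε : ℝ => (s + ε) • e) (nhdsWithin 0 (Set.Ioi 0))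
        (nhds ((s + 0) • e)) :=
      ((by fun_prop : Continuous fun ε : ℝ => (s + ε) • e).tendsto 0).mono_left nhdsWithin_le_nhds
    rw [add_zero] at h1
    exact ge_of_tendsto h1 (Filter.eventually_of_mem self_mem_nhdsWithin key)
  intro ε hε
  by_contra hnot
  obtain ⟨U, hU, hw⟩ := exists_isPosUltrafilter (w := (|t.evalWith T| - (s + ε) • e)⁺)
    (posPart_nonneg _) (fun h0 => hnot (sub_nonpos.1 (posPart_eq_zero.1 h0)))
  have hge : LEMod U ((s + ε) • e) |t.evalWith T| := by
    refine ⟨_, hw, ?_⟩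
    rw [← neg_sub, posPart_neg, inf_comm]
    exact posPart_inf_negPart_eq_zero _
  -- A negligible `e` would make `bound t • e` negligible, and with it the member of `U` on which
  -- the domination fails.
  have he0 : ¬ LEMod U e 0 := by
    intro h0
    have hb : 0 ≤ max (bound t) 0 := le_max_right _ _
    have h1 := IsPosUltrafilter.leMod_smul h0 hb
    rw [smul_zero] at h1
    refine hU.not_leMod_zero_of_mem hw (hU.leMod_trans (hU.leMod_of_le ?_) h1)
    refine sup_le ?_ (smul_nonneg hb he)
    refine (sub_le_self _ (smul_nonneg (add_nonneg hs hε.le) he)).trans ?_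
    exact (abs_evalWith_le_bound hT t).trans
      (smul_le_smul_of_nonneg_right (le_max_left _ _) he)
  have hz := fun x => hU.valueMod_spec he (hT x)
  -- Values are unique because `e` is not negligible, so taking them commutes with the lattice
  -- operations.
  let z : LatticeHom L (Set.Icc (-1 : ℝ) 1) := LatticeHom.mkIcc (fun x => valueMod U e (T x))
    (fun x => (hz x).1)
    (fun x y => hU.isValueMod_unique he0 (hz _).2
      (by rw [map_sup]; exact hU.isValueMod_sup he (hz x).2 (hz y).2))
    (fun x y => hU.isValueMod_unique he0 (hz _).2
      (by rw [map_inf]; exact hU.isValueMod_inf he (hz x).2 (hz y).2))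
  have h1 : IsValueMod U e (t.evalWith T) (t.evalWith fun x => (z x : ℝ)) :=
    isValueMod_evalWith hU he (fun x => (hz x).2) t
  have h2 : IsValueMod U e |t.evalWith T| |t.evalWith fun x => (z x : ℝ)| :=
    hU.isValueMod_sup he h1 (IsPosUltrafilter.isValueMod_neg h1)
  have h3 : IsValueMod U e ((s + ε) • e) (s + ε) := fun η hη =>
    ⟨hU.leMod_of_le (smul_le_smul_of_nonneg_right (by linarith) he),
      hU.leMod_of_le (smul_le_smul_of_nonneg_right (by linarith) he)⟩
  have := hU.le_of_isValueMod he0 h3 h2 hge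
  linarith [h z]

/-- A norm bound on `T` gives no common dominating element, so `T` is replaced by a truncation that
agrees with it on the variables of `t`. -/
theorem norm_evalWith_le (T : LatticeHom L X) (hT : ∀ x, ‖T x‖ ≤ 1) (t : Term L) {s : ℝ}
    (hs : 0 ≤ s)
    (h : ∀ z : LatticeHom L (Set.Icc (-1 : ℝ) 1), |t.evalWith fun x => (z x : ℝ)| ≤ s) :
    ‖t.evalWith T‖ ≤ 2 * s := by
  have key : ∀ (S : LatticeHom L X) (e : X), 0 ≤ e → ‖e‖ ≤ 2 → (∀ x, |S x| ≤ e) →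
      ‖t.evalWith S‖ ≤ 2 * s := by
    intro S e he he2 hS
    have h1 := abs_evalWith_le S he hS t hs h
    have h2 : ‖t.evalWith S‖ ≤ ‖s • e‖ :=
      norm_le_norm_of_abs_le_abs (h1.trans (le_abs_self _))
    rw [norm_smul, Real.norm_of_nonneg hs] at h2
    nlinarith
  rcases isEmpty_or_nonempty L with hL | hL
  · exact key T 0 le_rfl (by simp) fun x => hL.elim x
  · obtain ⟨a, b, hab⟩ := t.exists_varsIn
    -- Distributivity of a vector lattice is what makes the truncation of `T` a lattice
    -- homomorphism.
    let := AddCommGroup.toDistribLattice X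
    have he : 0 ≤ |T a| + |T b| := add_nonneg (abs_nonneg _) (abs_nonneg _)
    have hne : -(|T a| + |T b|) ≤ |T a| + |T b| := (neg_nonpos.2 he).trans he
    let S : LatticeHom L X :=
      { toFun := fun x => (T x ⊔ -(|T a| + |T b|)) ⊓ (|T a| + |T b|)
        map_sup' := fun x y => by rw [map_sup, sup_sup_distrib_right, inf_sup_right]
        map_inf' := fun x y => by rw [map_inf, sup_inf_right, inf_inf_distrib_right] }
    have hS : ∀ x, a ≤ x → x ≤ b → T x = S x := by
      intro x hax hxb
      have h1 : T x ≤ |T a| + |T b| := (OrderHomClass.mono T hxb).trans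
        ((le_abs_self _).trans (le_add_of_nonneg_left (abs_nonneg _)))
      have h2 : -(|T a| + |T b|) ≤ T x := by
        refine le_trans ?_ (OrderHomClass.mono T hax)
        rw [neg_le]
        exact (neg_le_abs _).trans (le_add_of_nonneg_right (abs_nonneg _))
      change T x = (T x ⊔ -(|T a| + |T b|)) ⊓ (|T a| + |T b|)
      rw [sup_eq_left.2 h2, inf_eq_left.2 h1]
    rw [Term.evalWith_congr hS hab]
    refine key S _ he ?_ fun x => abs_le'.2 ⟨inf_le_right, ?_⟩
    · refine (norm_add_le _ _).trans ?_
      rw [norm_abs_eq_norm, norm_abs_eq_norm]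
      linarith [hT a, hT b]
    · rw [neg_le]
      exact le_inf le_sup_right hne

end Domination

end FreeBanachLattice

/-! ### One-dimensional targets, bumps and maps of terms. -/

instance : IsBanachLattice (PUnit.{u + 1} → ℝ) where
  isOrderedAddMonoid := inferInstance
  isOrderedModule := inferInstance
  hasSolidNorm := ⟨fun _ b h => (pi_norm_le_iff_of_nonneg (norm_nonneg b)).2 fun i =>
    (norm_le_norm_of_abs_le_abs (h i)).trans (norm_le_pi_norm b i)⟩
  completeSpace := inferInstance

/-- For small `ε` this is positive on the assignments near the ray through `y` and zero away from
it, as seen on the coordinates in `s`, for `k ∈ s` with `y k ≠ 0`. -/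
def rayBump {L X : Type*} [AddCommGroup X] [Lattice X] [Module ℝ X] (s : Finset L) (y : L → ℝ)
    (k : L) (ε : ℝ) (v : L → X) : X :=
  ((ε * y k) • v k - ∑ j ∈ s, |y k • v j - y j • v k|) ⊔ 0

namespace BanachLatticeHom

variable {X Y Z : Type u} [NormedAddCommGroup X] [NormedSpace ℝ X] [Lattice X]
  [NormedAddCommGroup Y] [NormedSpace ℝ Y] [Lattice Y]
  [NormedAddCommGroup Z] [NormedSpace ℝ Z] [Lattice Z]

/-- The composition of Banach lattice homomorphisms. -/
def comp (S : BanachLatticeHom Y Z) (T : BanachLatticeHom X Y) : BanachLatticeHom X Z where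
  toCLM := S.toCLM.comp T.toCLM
  map_sup a b := by simp [T.map_sup, S.map_sup]
  map_inf a b := by simp [T.map_inf, S.map_inf]

theorem map_abs (T : BanachLatticeHom X Y) (a : X) : T |a| = |T a| := by
  rw [abs, abs, T.map_sup, map_neg]

theorem map_rayBump {L : Type*} (T : BanachLatticeHom X Y) (s : Finset L) (y : L → ℝ) (k : L)
    (ε : ℝ) (v : L → X) : T (rayBump s y k ε v) = rayBump s y k ε fun x => T (v x) := by
  simp only [rayBump, T.map_sup, map_sub, map_sum, T.map_abs, map_smul, map_zero]

theorem map_evalWith {L : Type*} (T : BanachLatticeHom X Y) (v : L → X)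
    (t : FreeBanachLattice.Term L) : T (t.evalWith v) = t.evalWith fun x => T (v x) := by
  induction t with
  | of x => rfl
  | zero => exact map_zero T.toCLM
  | add a b ha hb => simp only [FreeBanachLattice.Term.evalWith, map_add, ha, hb]
  | smul r a ha => simp only [FreeBanachLattice.Term.evalWith, map_smul, ha]
  | sup a b ha hb => simp only [FreeBanachLattice.Term.evalWith, T.map_sup, ha, hb]

end BanachLatticeHom

theorem FreeBanachLattice.evalWith_δ {L : Type u} [Lattice L] (t : Term L) :
    t.evalWith (δ L) = ((Pre.mk t : Pre L) : FBL L) := by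
  induction t with
  | of x => rfl
  | zero => exact UniformSpace.Completion.coe_zero.symm
  | add a b ha hb =>
    change a.evalWith (δ L) + b.evalWith (δ L) = ((Pre.mk a + Pre.mk b : Pre L) : FBL L)
    rw [UniformSpace.Completion.coe_add, ha, hb]
  | smul r a ha =>
    change r • a.evalWith (δ L) = ((r • Pre.mk a : Pre L) : FBL L)
    rw [UniformSpace.Completion.coe_smul, ha]
  | sup a b ha hb =>
    change a.evalWith (δ L) ⊔ b.evalWith (δ L) = ((Pre.mk a ⊔ Pre.mk b : Pre L) : FBL L)
    rw [coe_sup, ha, hb]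

/-- A lattice homomorphism to `[-1, 1]` as a lattice homomorphism to a one-dimensional Banach
lattice. -/
def LatticeHom.toPi {L : Type u} [Lattice L] (z : LatticeHom L (Set.Icc (-1 : ℝ) 1)) :
    LatticeHom L (PUnit.{u + 1} → ℝ) where
  -- Functions on a point replace `ℝ`, since the universal property ranges over Banach lattices in
  -- the universe `u`.
  toFun x _ := z x
  map_sup' x y := by rw [map_sup]; rfl
  map_inf' x y := by rw [map_inf]; rfl

theorem LatticeHom.norm_toPi_le {L : Type u} [Lattice L] (z : LatticeHom L (Set.Icc (-1 : ℝ) 1))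
    (x : L) : ‖z.toPi x‖ ≤ 1 :=
  (pi_norm_le_iff_of_nonneg zero_le_one).2 fun _ => abs_le.2 (z x).2

theorem LatticeHom.normBounded_toPi {L : Type u} [Lattice L]
    (z : LatticeHom L (Set.Icc (-1 : ℝ) 1)) : NormBounded z.toPi :=
  ⟨1, by rintro _ ⟨x, rfl⟩; exact z.norm_toPi_le x⟩

/-! ### The norm of a free Banach lattice up to a factor 2. -/

namespace IsFreeBanachLattice

variable {L : Type u} [Lattice L] {F : Type u} [NormedAddCommGroup F] [NormedSpace ℝ F]
  [Lattice F] [IsBanachLattice F] {δ : LatticeHom L F}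

/-- The identity is the lift of `δ` itself, so the norm clause of the universal property bounds
`supNorm δ` by the norm of the identity. -/
theorem norm_generator_le (hF : IsFreeBanachLattice L F δ) (x : L) : ‖δ x‖ ≤ 1 := by
  let I : BanachLatticeHom F F := ⟨ContinuousLinearMap.id ℝ F, fun _ _ => rfl, fun _ _ => rfl⟩
  have h1 : I = hF.lift δ hF.normBounded := hF.eq_lift δ hF.normBounded I fun _ => rfl
  have h2 : supNorm δ ≤ 1 := by
    rw [← hF.norm_lift δ hF.normBounded, ← h1]
    exact ContinuousLinearMap.norm_id_le
  exact (le_ciSup hF.normBounded x).trans h2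

/-- By uniqueness of lifts, the comparison map from the concrete model has a right inverse and is
onto. It carries the dense set of term classes to the values of terms at `δ`. -/
theorem dense_range_evalWith (hF : IsFreeBanachLattice L F δ) :
    Dense (Set.range fun t : FreeBanachLattice.Term L => t.evalWith δ) := by
  have hE := FreeBanachLattice.isFreeBanachLattice L
  let j := hE.lift δ hF.normBounded
  let k := hF.lift (FreeBanachLattice.δ L) hE.normBounded
  let I : BanachLatticeHom F F := ⟨ContinuousLinearMap.id ℝ F, fun _ _ => rfl, fun _ _ => rfl⟩
  have h1 : I = j.comp k := by
    rw [hF.eq_lift δ hF.normBounded (j.comp k), hF.eq_lift δ hF.normBounded I]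
    · exact fun _ => rfl
    · intro x
      change j (k (δ x)) = δ x
      rw [hF.lift_apply, hE.lift_apply]
  have hj : Function.Surjective j := fun f => ⟨k f, by
    change (j.comp k) f = f
    rw [← h1]
    rfl⟩
  refine (hj.denseRange.comp UniformSpace.Completion.denseRange_coe
    j.toCLM.continuous).mono ?_
  rintro _ ⟨a, rfl⟩
  induction a using Quotient.inductionOn with | _ t
  refine ⟨t, ?_⟩
  have h2 := j.map_evalWith (FreeBanachLattice.δ L) t
  rw [FreeBanachLattice.evalWith_δ] at h2
  refine Eq.trans ?_ h2.symm
  simp only [j, hE.lift_apply]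

/-- The Banach lattice homomorphism given by a lattice homomorphism to `[-1, 1]`. -/
noncomputable def evalHom (hF : IsFreeBanachLattice L F δ)
    (z : LatticeHom L (Set.Icc (-1 : ℝ) 1)) : BanachLatticeHom F (PUnit.{u + 1} → ℝ) :=
  hF.lift z.toPi z.normBounded_toPi

theorem evalHom_apply (hF : IsFreeBanachLattice L F δ) (z : LatticeHom L (Set.Icc (-1 : ℝ) 1))
    (x : L) : hF.evalHom z (δ x) = fun _ => (z x : ℝ) :=
  hF.lift_apply _ _ x

theorem norm_evalHom_le (hF : IsFreeBanachLattice L F δ) (z : LatticeHom L (Set.Icc (-1 : ℝ) 1))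
    (f : F) : ‖hF.evalHom z f‖ ≤ ‖f‖ := by
  have h : ‖(hF.evalHom z).toCLM‖ ≤ 1 := by
    rw [evalHom, hF.norm_lift]
    exact Real.iSup_le z.norm_toPi_le zero_le_one
  simpa using (hF.evalHom z).toCLM.le_of_opNorm_le h f

theorem evalHom_evalWith (hF : IsFreeBanachLattice L F δ)
    (z : LatticeHom L (Set.Icc (-1 : ℝ) 1)) (t : FreeBanachLattice.Term L) :
    hF.evalHom z (t.evalWith δ) = fun _ => t.evalWith fun x => (z x : ℝ) := by
  rw [BanachLatticeHom.map_evalWith]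
  simp only [evalHom_apply]
  induction t with
  | of x => rfl
  | zero => rfl
  | add a b ha hb => simp only [FreeBanachLattice.Term.evalWith, ha, hb]; rfl
  | smul r a ha => simp only [FreeBanachLattice.Term.evalWith, ha]; rfl
  | sup a b ha hb => simp only [FreeBanachLattice.Term.evalWith, ha, hb]; rfl

theorem evalHom_rayBump (hF : IsFreeBanachLattice L F δ) (z : LatticeHom L (Set.Icc (-1 : ℝ) 1))
    (s : Finset L) (y : L → ℝ) (k : L) (ε : ℝ) :
    hF.evalHom z (rayBump s y k ε δ) = fun _ => rayBump s y k ε fun x => (z x : ℝ) := by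
  rw [BanachLatticeHom.map_rayBump]
  simp only [evalHom_apply]
  ext i
  simp [rayBump, Finset.sum_apply]

/-- Up to a factor 2, the norm of a free Banach lattice is the supremum norm over the lattice
homomorphisms to `[-1, 1]`. -/
theorem norm_le_two_mul (hF : IsFreeBanachLattice L F δ) (f : F) {s : ℝ} (hs : 0 ≤ s)
    (h : ∀ z : LatticeHom L (Set.Icc (-1 : ℝ) 1), ‖hF.evalHom z f‖ ≤ s) : ‖f‖ ≤ 2 * s := by
  refine le_of_forall_pos_le_add fun ε hε => ?_
  obtain ⟨_, ⟨t, rfl⟩, hd⟩ := Metric.mem_closure_iff.1 (hF.dense_range_evalWith f) (ε / 3)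
    (by positivity)
  simp only [dist_eq_norm] at hd
  have h1 : ‖t.evalWith δ‖ ≤ 2 * (s + ε / 3) := by
    refine FreeBanachLattice.norm_evalWith_le δ hF.norm_generator_le t (by positivity) fun z => ?_
    have h2 : ‖hF.evalHom z (t.evalWith δ)‖ ≤ s + ε / 3 := by
      have h3 := hF.norm_evalHom_le z (f - t.evalWith δ)
      rw [map_sub, norm_sub_rev] at h3
      have h4 := norm_le_norm_add_norm_sub' (hF.evalHom z (t.evalWith δ)) (hF.evalHom z f)
      linarith [h z]
    rw [hF.evalHom_evalWith] at h2
    exact (norm_le_pi_norm (fun _ : PUnit.{u + 1} => t.evalWith fun x => (z x : ℝ))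
      PUnit.unit).trans h2
  have h5 := norm_le_norm_add_norm_sub' f (t.evalWith δ)
  linarith

/-- Both sides are Banach lattice homomorphisms on `F` that agree on generators. -/
theorem evalHom_inducedMap {M : Type u} [Lattice M] {L : Sublattice M} {δL : LatticeHom L F}
    {G : Type u} [NormedAddCommGroup G] [NormedSpace ℝ G] [Lattice G] [IsBanachLattice G]
    {δM : LatticeHom M G} (hF : IsFreeBanachLattice L F δL) (hG : IsFreeBanachLattice M G δM)
    {z : LatticeHom M (Set.Icc (-1 : ℝ) 1)} {y : LatticeHom L (Set.Icc (-1 : ℝ) 1)}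
    (h : ∀ x : L, z x = y x) (f : F) :
    hG.evalHom z (inducedMap L hF hG f) = hF.evalHom y f := by
  have : (hG.evalHom z).comp (inducedMap L hF hG) = hF.evalHom y := by
    refine hF.eq_lift _ _ _ fun x => ?_
    change hG.evalHom z (inducedMap L hF hG (δL x)) = _
    rw [inducedMap_apply, evalHom_apply, h]
    rfl
  rw [← this]
  rfl

end IsFreeBanachLattice

/-! ### Approximate and exact extension of homomorphisms. -/

/-- If a homomorphism does not vanish on the bump around the ray through `y`, then a truncated
multiple of it is near `y`. -/
theorem exists_near_of_rayBump_ne_zero {L M : Type*} [Lattice M] (i : L → M)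
    (z : LatticeHom M (Set.Icc (-1 : ℝ) 1)) (s : Finset L) {y : L → ℝ}
    (hy : ∀ x, y x ∈ Set.Icc (-1 : ℝ) 1) {k : L} {ε : ℝ} (hε : 0 < ε)
    (h : rayBump s y k ε (fun x => (z (i x) : ℝ)) ≠ 0) :
    ∃ z' : LatticeHom M (Set.Icc (-1 : ℝ) 1), ∀ j ∈ s, |(z' (i j) : ℝ) - y j| < ε := by
  have hpos : ∑ j ∈ s, |y k * z (i j) - y j * z (i k)| < ε * y k * z (i k) := by
    by_contra! hle
    exact h (sup_eq_right.2 (by simpa [sub_nonpos] using hle))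
  set q : ℝ := (z (i k) : ℝ) with hq
  have hyq : 0 < y k * q := by
    have h0 := (Finset.sum_nonneg fun j _ => abs_nonneg (y k * z (i j) - y j * q)).trans_lt hpos
    rw [mul_assoc] at h0
    exact pos_of_mul_pos_right h0 hε.le
  have hq0 : q ≠ 0 := by
    rintro h0
    simp [h0] at hyq
  -- The bump is nonzero only if `y k` and `q` have the same sign, so the rescaling that sends `q`
  -- to `y k` is by a positive factor.
  have hc : 0 < y k / q := by
    rw [show y k / q = y k * q / q ^ 2 by field_simp]
    positivity
  -- A monotone map between chains preserves `⊔` and `⊓`, so rescaling and clipping yield a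
  -- homomorphism again.
  have hm : Monotone fun r : ℝ => max (-1) (min 1 (y k / q * r)) := fun a b hab =>
    max_le_max le_rfl (min_le_min le_rfl (mul_le_mul_of_nonneg_left hab hc.le))
  refine ⟨LatticeHom.mkIcc (fun x => max (-1) (min 1 (y k / q * z x)))
    (fun x => ⟨le_max_left _ _, max_le (by norm_num) (min_le_left _ _)⟩)
    (fun a b => by rw [map_sup]; exact hm.map_sup _ _)
    (fun a b => by rw [map_inf]; exact hm.map_inf _ _), fun j hj => ?_⟩
  change |max (-1) (min 1 (y k / q * z (i j))) - y j| < ε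
  have h1 : |y k * z (i j) - y j * q| < ε * (y k * q) := by
    rw [← mul_assoc]
    exact (Finset.single_le_sum (f := fun j => |y k * z (i j) - y j * q|)
      (fun j _ => abs_nonneg _) hj).trans_lt hpos
  have h2 : |y k / q * z (i j) - y j| < ε := by
    have e1 : y k / q * z (i j) - y j = (y k * z (i j) - y j * q) / q := by field_simp
    rw [e1, abs_div, div_lt_iff₀ (abs_pos.2 hq0)]
    refine h1.trans_le (mul_le_mul_of_nonneg_left ?_ hε.le)
    refine (le_abs_self _).trans ?_
    rw [abs_mul]
    exact mul_le_of_le_one_left (abs_nonneg _) (abs_le.2 (hy k))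
  obtain ⟨h3, h4⟩ := abs_lt.1 h2
  -- As `y j` is in `[-1, 1]`, clipping to that interval keeps the error below `ε`.
  obtain ⟨h5, h6⟩ := hy j
  rw [abs_lt]
  constructor
  · have : y j - ε < max (-1) (min 1 (y k / q * z (i j))) :=
      lt_max_of_lt_right (lt_min (by linarith) (by linarith))
    linarith
  · have : max (-1) (min 1 (y k / q * z (i j))) < y j + ε :=
      max_lt (by linarith) (min_lt_of_right_lt (by linarith))
    linarith

/-- A map which is approximated on finite sets by restrictions of lattice homomorphisms to
`[-1, 1]` is such a restriction. -/
theorem exists_extension_of_forall_near {L M : Type*} [Lattice M] (i : L → M) (y : L → ℝ)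
    (h : ∀ (s : Finset L) (ε : ℝ), 0 < ε →
      ∃ z : LatticeHom M (Set.Icc (-1 : ℝ) 1), ∀ j ∈ s, |(z (i j) : ℝ) - y j| < ε) :
    ∃ z : LatticeHom M (Set.Icc (-1 : ℝ) 1), ∀ x, (z (i x) : ℝ) = y x := by
  let K : Set (M → ℝ) := {f | (∀ x, f x ∈ Set.Icc (-1 : ℝ) 1) ∧
    (∀ a b, f (a ⊔ b) = f a ⊔ f b) ∧ ∀ a b, f (a ⊓ b) = f a ⊓ f b}
  -- The homomorphisms form a closed subset of a product of intervals, hence a compact one;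
  -- restriction is continuous, so the set of restrictions is closed.
  have hK : IsCompact K := by
    refine (isCompact_univ_pi fun _ : M => isCompact_Icc (a := (-1 : ℝ)) (b := 1)).of_isClosed_subset
      ?_ fun f hf x _ => hf.1 x
    simp only [K, Set.ofPred_and, Set.ofPred_forall]
    refine ((isClosed_iInter fun x => isClosed_Icc.preimage (continuous_apply x)).inter
      ((isClosed_iInter fun a => isClosed_iInter fun b => isClosed_eq ?_ ?_).inter
        (isClosed_iInter fun a => isClosed_iInter fun b => isClosed_eq ?_ ?_))) <;> fun_prop
  have hcont : Continuous fun (f : M → ℝ) (x : L) => f (i x) := by fun_prop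
  have hy : y ∈ closure ((fun (f : M → ℝ) (x : L) => f (i x)) '' K) := by
    -- A finite set of coordinates allows one common radius, the smallest one.
    have hb := Filter.hasBasis_pi_same_index (fun x => Metric.nhds_basis_ball (x := y x))
      fun I r hI hr => by
        rcases I.eq_empty_or_nonempty with rfl | hne
        · exact ⟨1, one_pos, by simp⟩
        · obtain ⟨x, hx, hmin⟩ := hI.exists_minimalFor r I hne
          refine ⟨r x, hr x hx, fun w hw => Metric.ball_subset_ball ?_⟩
          exact (le_total (r x) (r w)).elim id fun hle => hmin hw hle
    rw [← nhds_pi] at hb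
    rw [mem_closure_iff_nhds_basis hb]
    rintro ⟨I, ε⟩ ⟨hI, hε⟩
    obtain ⟨z, hz⟩ := h hI.toFinset ε hε
    refine ⟨_, ⟨fun x => (z x : ℝ), ⟨fun x => (z x).2, fun a b => ?_, fun a b => ?_⟩, rfl⟩,
      fun x hx => ?_⟩
    · exact congrArg Subtype.val (map_sup z a b)
    · exact congrArg Subtype.val (map_inf z a b)
    · simpa [Real.dist_eq] using hz x (by simpa using hx)
  rw [(hK.image hcont).isClosed.closure_eq] at hy
  obtain ⟨f, hf, hfy⟩ := hy
  exact ⟨LatticeHom.mkIcc f hf.1 hf.2.1 hf.2.2, fun x => congrFun hfy x⟩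

/-! ### The equivalence of the three conditions. -/

theorem theorem4p3 {M : Type u} [DistribLattice M] (L : Sublattice M)
    {F : Type u} [NormedAddCommGroup F] [NormedSpace ℝ F] [Lattice F] [IsBanachLattice F]
    {G : Type u} [NormedAddCommGroup G] [NormedSpace ℝ G] [Lattice G] [IsBanachLattice G]
    (δL : LatticeHom L F) (δM : LatticeHom M G)
    (hF : IsFreeBanachLattice L F δL) (hG : IsFreeBanachLattice M G δM) :
    List.TFAE [
      (inducedMap L hF hG).IsIntoIsomorphism,
      Function.Injective (inducedMap L hF hG),
      ∀ y : LatticeHom L (Set.Icc (-1 : ℝ) 1),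
        ∃ z : LatticeHom M (Set.Icc (-1 : ℝ) 1), ∀ x : L, z x = y x] := by
  tfae_have 1 → 2 := by
    rintro ⟨c, hc, h⟩
    refine (injective_iff_map_eq_zero (inducedMap L hF hG).toCLM).2 fun f hf => ?_
    have h1 := h f
    rw [hf, norm_zero] at h1
    exact norm_le_zero_iff.1 (nonpos_of_mul_nonpos_right h1 hc)
  tfae_have 2 → 3 := by
    intro hinj y
    suffices h : ∃ z : LatticeHom M (Set.Icc (-1 : ℝ) 1), ∀ x : L, (z x : ℝ) = y x by
      obtain ⟨z, hz⟩ := h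
      exact ⟨z, fun x => Subtype.ext (hz x)⟩
    -- The bump needs a coordinate `k` with `y k ≠ 0`; the zero homomorphism extends by zero.
    by_cases hy0 : ∀ x, (y x : ℝ) = 0
    · exact ⟨LatticeHom.mkIcc (fun _ => 0) (by simp) (by simp) (by simp), fun x => (hy0 x).symm⟩
    push Not at hy0
    obtain ⟨k, hk⟩ := hy0
    refine exists_extension_of_forall_near _ _ fun s ε hε => ?_
    by_contra hnot
    have hzero : inducedMap L hF hG (rayBump s (fun x => (y x : ℝ)) k ε δL) = 0 := by
      -- The norm estimate with bound 0: homomorphisms from `M` to `[-1, 1]` separate the points of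
      -- `G`.
      refine norm_le_zero_iff.1 ((hG.norm_le_two_mul _ le_rfl fun z => ?_).trans_eq (mul_zero 2))
      rw [hF.evalHom_inducedMap hG (y := z.comp L.subtype) (fun _ => rfl), hF.evalHom_rayBump,
        norm_le_zero_iff]
      ext i
      by_contra hne
      exact hnot (exists_near_of_rayBump_ne_zero _ z s (fun x => (y x).2) hε hne)
    have hb : rayBump s (fun x => (y x : ℝ)) k ε δL = 0 := hinj (by rw [hzero, map_zero])
    have h1 := congrFun (hF.evalHom_rayBump y s (fun x => (y x : ℝ)) k ε) PUnit.unit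
    rw [hb, map_zero] at h1
    have h2 : 0 < (y k : ℝ) * y k := mul_self_pos.2 hk
    -- At `y` itself every penalty term of the bump cancels.
    have h3 : rayBump s (fun x => (y x : ℝ)) k ε (fun x => (y x : ℝ)) = ε * (y k * y k) := by
      have : ∀ j, (y k : ℝ) * y j - y j * y k = 0 := fun j => by ring
      simp only [rayBump, smul_eq_mul, this, abs_zero, Finset.sum_const_zero, sub_zero, mul_assoc]
      exact sup_eq_left.2 (by positivity)
    rw [h3] at h1
    exact (mul_pos hε h2).ne h1
  tfae_have 3 → 1 := by
    intro h
    refine ⟨1 / 2, by norm_num, fun f => ?_⟩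
    have := hF.norm_le_two_mul f (norm_nonneg (inducedMap L hF hG f)) fun y => by
      obtain ⟨z, hz⟩ := h y
      rw [← hF.evalHom_inducedMap hG hz]
      exact hG.norm_evalHom_le z _
    linarith
  tfae_finish
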